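/- Let $H$ be a separable complex Hilbert space and let $U:H\to H$ be a unitary operator. The following are equivalent. (i) $U$ is recurrent, that is, for every non-empty open set $V\subseteq H$ there is a positive integer $k$ such that $V\cap U^{-k}(V)\neq\emptyset$. (ii) $U$ is rigid, that is, there is a strictly increasing sequence of positive integers $(k_n)_{n\ge 1}$ such that $U^{k_n}x\to x$ in norm for every $x\in H$ (i.e. $U^{k_n}\to I$ in the strong operator topology). -/

import Mathlib

open Filter Topology

/-- A bounded operator `T` on `X` is recurrent if every non-empty open set `V` meets
`T⁻ᵏ(V)` for some positive integer `k`. -/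
def IsRecurrentOperator {X : Type*} [NormedAddCommGroup X] [NormedSpace ℂ X]
    (T : X →L[ℂ] X) : Prop :=
  ∀ V : Set X, IsOpen V → V.Nonempty → ∃ k : ℕ, 0 < k ∧ (V ∩ (T ^ k) ⁻¹' V).Nonempty

/-- A bounded operator `T` on `X` is rigid if there is one strictly increasing sequence of
positive integers `k n` along which `T ^ k n` converges to the identity in the strong operator
topology, i.e. pointwise on `X` in norm. -/
def IsRigidOperator {X : Type*} [NormedAddCommGroup X] [NormedSpace ℂ X]
    (T : X →L[ℂ] X) : Prop :=
  ∃ k : ℕ → ℕ, StrictMono k ∧ (∀ n, 0 < k n) ∧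
    ∀ x : X, Tendsto (fun n => (T ^ k n) x) atTop (𝓝 x)

/-! A rigid operator is recurrent at once. For the converse, an isometry that is recurrent returns
*every* vector `x` close to itself, since a ball around `x` moves rigidly; so each single vector `x`
has its own sequence `k n` with `U ^ k n x → x`. The point is to find one vector whose sequence works
for all of `H`.

Take a dense sequence `y j`, let `K j` be the closed span of the two-sided `U`-orbits of the `y i`,
`i < j`, and let `x j` be the component of `y j` orthogonal to `K j` (`orbitGramSchmidt`). The orbits
of the `x j` are pairwise orthogonal, so for `x = ∑ c j • x j` with positive weights `c j` one has
`c j * ‖U ^ k x j - x j‖ ≤ ‖U ^ k x - x‖`: a sequence along which `x` returns makes every `x j`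
return. The vectors returning along a fixed sequence form a closed subspace invariant under
the powers of `U` (`returnSubmodule`), so this subspace contains every `y j`, by induction on `j`,
and is therefore all of `H`. In the language of von Neumann algebras, `x` is a cyclic vector for the
commutant of `U`; no spectral theorem is needed. -/

/-! ### Return times of isometries -/

section Isometry

variable {X : Type*} [NormedAddCommGroup X] [NormedSpace ℂ X] {T : X →L[ℂ] X}

lemma IsRigidOperator.isRecurrentOperator (hT : IsRigidOperator T) : IsRecurrentOperator T := by
  rintro V hV ⟨x, hx⟩
  obtain ⟨k, -, hpos, hk⟩ := hT
  obtain ⟨n, hn⟩ := ((hk x).eventually (hV.mem_nhds hx)).exists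
  exact ⟨k n, hpos n, x, hx, hn⟩

lemma norm_pow_apply_of_norm_apply (hT : ∀ x, ‖T x‖ = ‖x‖) (n : ℕ) (x : X) :
    ‖(T ^ n) x‖ = ‖x‖ := by
  induction n with
  | zero => simp
  | succ n ih => rw [pow_succ', mul_apply_eq_comp, hT, ih]

lemma norm_pow_mul_apply_sub_le (hT : ∀ x, ‖T x‖ = ‖x‖) (k m : ℕ) (x : X) :
    ‖(T ^ (k * m)) x - x‖ ≤ m * ‖(T ^ k) x - x‖ := by
  induction m with
  | zero => simp
  | succ m ih =>
    have h : (T ^ (k * (m + 1))) x - x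
        = (T ^ (k * m)) ((T ^ k) x - x) + ((T ^ (k * m)) x - x) := by
      rw [mul_add, mul_one, pow_add, mul_apply_eq_comp, map_sub]
      abel
    calc _ ≤ ‖(T ^ (k * m)) ((T ^ k) x - x)‖ + ‖(T ^ (k * m)) x - x‖ := h ▸ norm_add_le _ _
      _ ≤ ‖(T ^ k) x - x‖ + m * ‖(T ^ k) x - x‖ := by
        rw [norm_pow_apply_of_norm_apply hT]; gcongr
      _ = _ := by push_cast; ring

lemma IsRecurrentOperator.exists_norm_pow_apply_sub_lt (hrec : IsRecurrentOperator T)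
    (hT : ∀ x, ‖T x‖ = ‖x‖) (x : X) {ε : ℝ} (hε : 0 < ε) :
    ∃ k : ℕ, 0 < k ∧ ‖(T ^ k) x - x‖ < ε := by
  obtain ⟨k, hk, y, hy, hy'⟩ := hrec (Metric.ball x (ε / 2)) Metric.isOpen_ball
    ⟨x, Metric.mem_ball_self (by positivity)⟩
  refine ⟨k, hk, ?_⟩
  rw [Set.mem_preimage, mem_ball_iff_norm] at hy'
  rw [mem_ball_iff_norm'] at hy
  calc ‖(T ^ k) x - x‖ = ‖(T ^ k) (x - y) + ((T ^ k) y - x)‖ := by rw [map_sub]; congr 1; abel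
    _ ≤ ‖x - y‖ + ‖(T ^ k) y - x‖ :=
      (norm_add_le _ _).trans_eq (by rw [norm_pow_apply_of_norm_apply hT])
    _ < ε := by linarith

/-- Each vector returns to itself along some sequence, which may depend on the vector. -/
lemma IsRecurrentOperator.exists_tendsto_pow_apply (hrec : IsRecurrentOperator T)
    (hT : ∀ x, ‖T x‖ = ‖x‖) (x : X) :
    ∃ k : ℕ → ℕ, StrictMono k ∧ (∀ n, 0 < k n) ∧
      Tendsto (fun n => (T ^ k n) x) atTop (𝓝 x) := by
  have hfreq (n : ℕ) : ∃ᶠ k in atTop, 0 < k ∧ ‖(T ^ k) x - x‖ < 1 / ((n : ℝ) + 1) := by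
    refine frequently_atTop.2 fun N => ?_
    -- A return time for a much smaller tolerance has a large multiple that is still a return time.
    obtain ⟨k, hk, hlt⟩ := hrec.exists_norm_pow_apply_sub_lt hT x
      (ε := 1 / ((n : ℝ) + 1) / ((N + 1 : ℕ) : ℝ)) (by positivity)
    refine ⟨k * (N + 1), by nlinarith, by positivity, ?_⟩
    rw [lt_div_iff₀' (by positivity)] at hlt
    exact (norm_pow_mul_apply_sub_le hT k (N + 1) x).trans_lt hlt
  obtain ⟨k, hmono, hk⟩ := extraction_forall_of_frequently hfreq
  refine ⟨k, hmono, fun n => (hk n).1, ?_⟩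
  rw [tendsto_iff_norm_sub_tendsto_zero]
  exact squeeze_zero (fun _ => norm_nonneg _) (fun n => (hk n).2.le)
    tendsto_one_div_add_atTop_nhds_zero_nat

/-- The subspace of vectors that return to themselves under `T` along the sequence `k`. -/
def returnSubmodule (T : X →L[ℂ] X) (k : ℕ → ℕ) : Submodule ℂ X where
  carrier := {x | Tendsto (fun n => (T ^ k n) x) atTop (𝓝 x)}
  add_mem' ha hb := by simpa using ha.add hb
  zero_mem' := by simp
  smul_mem' c x hx := by simpa only [Set.mem_ofPred_eq, map_smul] using hx.const_smul c

lemma mem_returnSubmodule {k : ℕ → ℕ} {x : X} :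
    x ∈ returnSubmodule T k ↔ Tendsto (fun n => (T ^ k n) x) atTop (𝓝 x) := Iff.rfl

lemma isClosed_returnSubmodule (hT : ∀ x, ‖T x‖ = ‖x‖) (k : ℕ → ℕ) :
    IsClosed (returnSubmodule T k : Set X) := by
  refine isClosed_of_closure_subset fun x hx => Metric.tendsto_atTop.2 fun ε hε => ?_
  obtain ⟨y, hy, hxy⟩ := Metric.mem_closure_iff.1 hx (ε / 3) (by positivity)
  obtain ⟨N, hN⟩ := Metric.tendsto_atTop.1 (mem_returnSubmodule.1 hy) (ε / 3) (by positivity)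
  refine ⟨N, fun n hn => ?_⟩
  have h1 : dist ((T ^ k n) x) ((T ^ k n) y) = dist x y := by
    rw [dist_eq_norm, ← map_sub, norm_pow_apply_of_norm_apply hT, dist_eq_norm]
  have h2 := dist_triangle4 ((T ^ k n) x) ((T ^ k n) y) y x
  rw [dist_comm y x] at h2
  linarith [hN n hn]

lemma apply_mem_returnSubmodule {k : ℕ → ℕ} {S : X →L[ℂ] X} (hS : Commute S T) {x : X}
    (hx : x ∈ returnSubmodule T k) : S x ∈ returnSubmodule T k := by
  have h (n : ℕ) : (T ^ k n) (S x) = S ((T ^ k n) x) := by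
    rw [← mul_apply_eq_comp, ← mul_apply_eq_comp, (hS.pow_right _).eq]
  simpa only [mem_returnSubmodule, h, Function.comp_def] using
    (S.continuous.tendsto x).comp (mem_returnSubmodule.1 hx)

end Isometry

/-! ### Orthogonal cyclic subspaces of a unitary operator -/

section Unitary

variable {H : Type*} [NormedAddCommGroup H] [InnerProductSpace ℂ H]

/-- If the displacements of the `w j` under `T ^ k` are pairwise orthogonal, the displacement of a
weighted sum of the `w j` controls each of them. -/
lemma mul_norm_pow_apply_sub_le {T : H →L[ℂ] H} {w : ℕ → H} {c : ℕ → ℝ} {x : H} {k : ℕ}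
    (hx : HasSum (fun j => (c j : ℂ) • w j) x) (hc : ∀ j, 0 < c j)
    (horth : ∀ i j, i ≠ j → inner ℂ ((T ^ k) (w i) - w i) ((T ^ k) (w j) - w j) = 0) (i : ℕ) :
    c i * ‖(T ^ k) (w i) - w i‖ ≤ ‖(T ^ k) x - x‖ := by
  set d : ℕ → H := fun j => (T ^ k) (w j) - w j with hd
  have hsum : HasSum (fun j => (c j : ℂ) • d j) ((T ^ k) x - x) := by
    simpa only [hd, smul_sub, map_smul] using ((T ^ k).hasSum hx).sub hx
  have hinner : inner ℂ (d i) ((T ^ k) x - x) = c i * (‖d i‖ : ℂ) ^ 2 := by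
    have h1 := (innerSL ℂ (d i)).hasSum hsum
    have h2 := hasSum_single (f := fun j => innerSL ℂ (d i) ((c j : ℂ) • d j)) i
      fun j hj => by
        rw [innerSL_apply_apply, inner_smul_right, horth i j hj.symm, mul_zero]
    have h3 := h1.unique h2
    rwa [innerSL_apply_apply, innerSL_apply_apply, inner_smul_right,
      inner_self_eq_norm_sq_to_K] at h3
  have hle : c i * ‖d i‖ ^ 2 ≤ ‖d i‖ * ‖(T ^ k) x - x‖ := by
    have := norm_inner_le_norm (𝕜 := ℂ) (d i) ((T ^ k) x - x)
    rw [hinner] at this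
    simpa [abs_of_pos (hc i)] using this
  rcases (norm_nonneg (d i)).eq_or_lt with h | h
  · change c i * ‖d i‖ ≤ _
    rw [← h, mul_zero]
    exact norm_nonneg _
  · exact le_of_mul_le_mul_left (by linarith) h

variable [CompleteSpace H]

lemma exists_pos_hasSum_smul (w : ℕ → H) :
    ∃ c : ℕ → ℝ, (∀ j, 0 < c j) ∧ ∃ x, HasSum (fun j => (c j : ℂ) • w j) x := by
  refine ⟨fun j => (1 / 2) ^ j / (1 + ‖w j‖), fun j => by positivity, ?_⟩
  refine Summable.of_norm_bounded summable_geometric_two fun j => ?_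
  have h : (0 : ℝ) < 1 + ‖w j‖ := by positivity
  rw [norm_smul, Complex.norm_real, Real.norm_of_nonneg (by positivity), div_mul_eq_mul_div,
    div_le_iff₀ h]
  gcongr
  linarith

lemma inner_unitary_apply_apply (u : unitary (H →L[ℂ] H)) (a b : H) :
    inner ℂ ((u : H →L[ℂ] H) a) ((u : H →L[ℂ] H) b) = inner ℂ a b := by
  rw [← ContinuousLinearMap.adjoint_inner_right, ← ContinuousLinearMap.star_eq_adjoint,
    ← mul_apply_eq_comp, Unitary.coe_star_mul_self, one_apply_eq_self]

lemma zpow_add_apply (u : unitary (H →L[ℂ] H)) (m n : ℤ) (x : H) :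
    ((u ^ (m + n) : unitary (H →L[ℂ] H)) : H →L[ℂ] H) x
      = ((u ^ m : unitary (H →L[ℂ] H)) : H →L[ℂ] H)
        (((u ^ n : unitary (H →L[ℂ] H)) : H →L[ℂ] H) x) := by
  rw [zpow_add]; rfl

/-- The closed span of the two-sided orbits under `u` of the vectors `y i` with `i < j`. -/
def orbitSpan (u : unitary (H →L[ℂ] H)) (y : ℕ → H) (j : ℕ) : Submodule ℂ H :=
  (Submodule.span ℂ {v | ∃ i < j, ∃ n : ℤ,
    v = ((u ^ n : unitary (H →L[ℂ] H)) : H →L[ℂ] H) (y i)}).topologicalClosure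

instance (u : unitary (H →L[ℂ] H)) (y : ℕ → H) (j : ℕ) : CompleteSpace (orbitSpan u y j) :=
  (Submodule.isClosed_topologicalClosure _).completeSpace_coe

lemma zpow_apply_mem_orbitSpan (u : unitary (H →L[ℂ] H)) (y : ℕ → H) {i j : ℕ} (hij : i < j)
    (n : ℤ) : ((u ^ n : unitary (H →L[ℂ] H)) : H →L[ℂ] H) (y i) ∈ orbitSpan u y j :=
  Submodule.le_topologicalClosure _ (Submodule.subset_span ⟨i, hij, n, rfl⟩)

lemma orbitSpan_le {u : unitary (H →L[ℂ] H)} {y : ℕ → H} {j : ℕ} {S : Submodule ℂ H}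
    (hS : IsClosed (S : Set H))
    (h : ∀ i < j, ∀ n : ℤ, ((u ^ n : unitary (H →L[ℂ] H)) : H →L[ℂ] H) (y i) ∈ S) :
    orbitSpan u y j ≤ S :=
  Submodule.topologicalClosure_minimal _
    (Submodule.span_le.2 (by rintro _ ⟨i, hi, n, rfl⟩; exact h i hi n)) hS

lemma orbitSpan_mono (u : unitary (H →L[ℂ] H)) (y : ℕ → H) : Monotone (orbitSpan u y) :=
  fun _ _ hij => orbitSpan_le (Submodule.isClosed_topologicalClosure _)
    fun _ hl n => zpow_apply_mem_orbitSpan u y (hl.trans_le hij) n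

lemma zpow_apply_mem_orbitSpan_of_mem (u : unitary (H →L[ℂ] H)) (y : ℕ → H) {j : ℕ} (m : ℤ)
    {v : H} (hv : v ∈ orbitSpan u y j) :
    ((u ^ m : unitary (H →L[ℂ] H)) : H →L[ℂ] H) v ∈ orbitSpan u y j := by
  let A : H →L[ℂ] H := ((u ^ m : unitary (H →L[ℂ] H)) : H →L[ℂ] H)
  have h : orbitSpan u y j ≤ (orbitSpan u y j).comap (A : H →ₗ[ℂ] H) := by
    refine orbitSpan_le ((Submodule.isClosed_topologicalClosure _).preimage A.continuous) ?_
    intro i hi n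
    rw [Submodule.mem_comap]
    change A _ ∈ _
    rw [← zpow_add_apply]
    exact zpow_apply_mem_orbitSpan u y hi _
  exact h hv

/-- The component of `y j` orthogonal to the orbits of all `y i` with `i < j`: the Gram–Schmidt
process carried out on cyclic subspaces in place of lines, and without normalization (so the
result may be zero). -/
noncomputable def orbitGramSchmidt (u : unitary (H →L[ℂ] H)) (y : ℕ → H) (j : ℕ) : H :=
  y j - (orbitSpan u y j).starProjection (y j)

lemma inner_orbitGramSchmidt_of_mem (u : unitary (H →L[ℂ] H)) (y : ℕ → H) {j : ℕ} {v : H}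
    (hv : v ∈ orbitSpan u y j) : inner ℂ v (orbitGramSchmidt u y j) = 0 :=
  Submodule.inner_right_of_mem_orthogonal hv
    (Submodule.sub_starProjection_mem_orthogonal (y j))

lemma orbitGramSchmidt_mem (u : unitary (H →L[ℂ] H)) (y : ℕ → H) {i j : ℕ} (hij : i < j) :
    orbitGramSchmidt u y i ∈ orbitSpan u y j :=
  sub_mem (by simpa using zpow_apply_mem_orbitSpan u y hij 0)
    (orbitSpan_mono u y hij.le (Submodule.starProjection_apply_mem _ _))

/-- Distinct vectors produced by `orbitGramSchmidt` have orthogonal two-sided orbits. -/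
lemma inner_zpow_orbitGramSchmidt (u : unitary (H →L[ℂ] H)) (y : ℕ → H) {i j : ℕ} (hij : i ≠ j)
    (m n : ℤ) :
    inner ℂ (((u ^ m : unitary (H →L[ℂ] H)) : H →L[ℂ] H) (orbitGramSchmidt u y i))
      (((u ^ n : unitary (H →L[ℂ] H)) : H →L[ℂ] H) (orbitGramSchmidt u y j)) = 0 := by
  wlog h : i < j generalizing i j m n
  · exact inner_eq_zero_symm.1 (this hij.symm n m (hij.lt_or_gt.resolve_left h))
  rw [show m = n + (m - n) by ring, zpow_add_apply, inner_unitary_apply_apply]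
  exact inner_orbitGramSchmidt_of_mem u y
    (zpow_apply_mem_orbitSpan_of_mem u y _ (orbitGramSchmidt_mem u y h))

/-- Some single vector is such that any sequence along which it returns is a rigidity sequence. -/
lemma exists_forall_returnSubmodule_eq_top [TopologicalSpace.SeparableSpace H]
    (u : unitary (H →L[ℂ] H)) :
    ∃ x : H, ∀ k : ℕ → ℕ, x ∈ returnSubmodule (u : H →L[ℂ] H) k →
      returnSubmodule (u : H →L[ℂ] H) k = ⊤ := by
  let y := TopologicalSpace.denseSeq H
  let w := orbitGramSchmidt u y
  obtain ⟨c, hc, x, hx⟩ := exists_pos_hasSum_smul w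
  refine ⟨x, fun k hk => ?_⟩
  set R := returnSubmodule (u : H →L[ℂ] H) k
  have hclosed : IsClosed (R : Set H) := isClosed_returnSubmodule (Unitary.norm_map u) k
  have hw (i : ℕ) : w i ∈ R := by
    refine mem_returnSubmodule.2 (tendsto_iff_norm_sub_tendsto_zero.2 ?_)
    have hlim := (tendsto_iff_norm_sub_tendsto_zero.1 (mem_returnSubmodule.1 hk)).div_const (c i)
    rw [zero_div] at hlim
    refine squeeze_zero (fun _ => norm_nonneg _) (fun n => ?_) hlim
    rw [le_div_iff₀' (hc i)]
    refine mul_norm_pow_apply_sub_le hx hc (fun a b hab => ?_) i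
    have h (m l : ℕ) : inner ℂ (((u : H →L[ℂ] H) ^ m) (w a)) (((u : H →L[ℂ] H) ^ l) (w b)) = 0 := by
      simpa using inner_zpow_orbitGramSchmidt u y hab m l
    have h0 (m : ℕ) := h m 0
    have h1 (m : ℕ) := h 0 m
    simp only [pow_zero, one_apply_eq_self] at h0 h1
    simp only [inner_sub_left, inner_sub_right, h, h0, h1, by simpa using h 0 0, sub_zero]
  have hy (j : ℕ) : y j ∈ R := by
    induction j using Nat.strong_induction_on with
    | _ j ih =>
      have hle : orbitSpan u y j ≤ R := orbitSpan_le hclosed fun i hi n =>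
        apply_mem_returnSubmodule (congrArg Subtype.val (Commute.zpow_self u n).eq) (ih i hi)
      have := R.add_mem (hw j) (hle (Submodule.starProjection_apply_mem _ (y j)))
      simpa [w, orbitGramSchmidt] using this
  rw [eq_top_iff]
  intro v _
  exact hclosed.closure_subset_iff.2 (Set.range_subset_iff.2 hy)
    (TopologicalSpace.denseRange_denseSeq H v)

end Unitary

theorem propositionp {H : Type*} [NormedAddCommGroup H] [InnerProductSpace ℂ H]
    [CompleteSpace H] [TopologicalSpace.SeparableSpace H]
    (U : H →L[ℂ] H) (hU : U ∈ unitary (H →L[ℂ] H)) :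
    IsRecurrentOperator U ↔ IsRigidOperator U := by
  refine ⟨fun hrec => ?_, IsRigidOperator.isRecurrentOperator⟩
  obtain ⟨x, hx⟩ := exists_forall_returnSubmodule_eq_top ⟨U, hU⟩
  obtain ⟨k, hmono, hpos, hk⟩ :=
    hrec.exists_tendsto_pow_apply (Unitary.norm_map ⟨U, hU⟩) x
  refine ⟨k, hmono, hpos, fun v => ?_⟩
  rw [← mem_returnSubmodule, show returnSubmodule U k = ⊤ from hx k hk]
  trivial
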